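/- Let $n\ge 2$ agents $A_1,\dots,A_n$ share a finite collection of EPR pairs $(|00\rangle+|11\rangle)/\sqrt2$, each pair being held by two different agents (two agents may share several pairs), and no other entanglement. The EPR graph is the undirected graph on the $n$ agents in which two agents are adjacent if and only if they share an EPR pair; a spanning EPR tree is a spanning tree of this graph. A pure $n$-partite maximally entangled state is an $n$-qubit state, one qubit per agent, of the form $(U_1\otimes\cdots\otimes U_n)\,(|0\cdots0\rangle+|1\cdots1\rangle)/\sqrt2$ with unitary $U_i$; in particular the CAT (GHZ) state itself. A state can be prepared if some LOCC protocol (finitely many steps, in each of which one agent applies a quantum operation to her own qubits, local ancillas included, or sends one classical bit (cbit) to another agent, depending only on her own earlier measurement outcomes and received cbits) turns the EPR pairs into it exactly and with certainty, possibly next to other qubits that are in a product state with it. Let $|\varphi\rangle$ be a pure $n$-partite maximally entangled state. Then: 1. $|\varphi\rangle$ can be prepared by LOCC if and only if the EPR graph is connected. 2. If the EPR graph is connected, then $|\varphi\rangle$ can be prepared by an LOCC protocol that communicates at most $3n-5=O(n)$ cbits. 3. The EPR pairs along any spanning EPR tree suffice: for every spanning tree $T$ of the EPR graph there are $n-1$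 of the EPR pairs, one for each edge of $T$, such that $|\varphi\rangle$ can be prepared from these pairs alone by an LOCC protocol that communicates at most $3n-5$ cbits. -/

import Mathlib

noncomputable section

namespace LOCC

/-! ### Qubit registers -/

/-- Labels of the computational basis of a register of qubits indexed by `Q`. -/
abbrev Config (Q : Type*) := Q → Fin 2

/-- (Unnormalised) state vectors of a register of qubits indexed by `Q`, written in the
computational basis. -/
abbrev StateVec (Q : Type*) := Config Q → ℂ

/-- The `n`-partite CAT (GHZ) state `(|00…0⟩ + |11…1⟩)/√2`, one qubit per agent. -/
def catState (n : ℕ) : StateVec (Fin n) := fun x =>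
  ((if ∀ i, x i = 0 then 1 else 0) + (if ∀ i, x i = 1 then 1 else 0)) / (Real.sqrt 2 : ℂ)

/-- A pure `n`-partite maximally entangled state: the image of the CAT state under a local
unitary `U₁ ⊗ ⋯ ⊗ Uₙ`. -/
def IsMaxEntangled {n : ℕ} (φ : StateVec (Fin n)) : Prop :=
  ∃ U : Fin n → Matrix (Fin 2) (Fin 2) ℂ,
    (∀ i, U i ∈ Matrix.unitaryGroup (Fin 2) ℂ) ∧
    ∀ x, φ x = ∑ y : Config (Fin n), (∏ i, U i (x i) (y i)) * catState n y

/-! ### Networks of EPR pairs -/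

/-- `n` agents sharing EPR pairs labelled by `ι`. The two qubits of the pair `k` are held by the
two different agents `endpoint k 0` and `endpoint k 1`. Two agents may share several pairs. -/
structure EPRNetwork (n : ℕ) (ι : Type*) where
  endpoint : ι → Fin 2 → Fin n
  endpoint_ne : ∀ k, endpoint k 0 ≠ endpoint k 1

/-- The EPR graph: two agents are adjacent if and only if they share an EPR pair. -/
def EPRNetwork.eprGraph {n : ℕ} {ι : Type*} (N : EPRNetwork n ι) : SimpleGraph (Fin n) :=
  SimpleGraph.fromRel fun i j => ∃ k, N.endpoint k 0 = i ∧ N.endpoint k 1 = j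

/-- The network that consists of the EPR pairs in `s` only. -/
def EPRNetwork.restrict {n : ℕ} {ι : Type*} (N : EPRNetwork n ι) (s : Finset ι) :
    EPRNetwork n s where
  endpoint k := N.endpoint k
  endpoint_ne k := N.endpoint_ne k

/-- All the qubits: two for each EPR pair, and `anc i` ancilla qubits of each agent `i`. -/
abbrev NetQubit {n : ℕ} (ι : Type*) (anc : Fin n → ℕ) := (ι × Fin 2) ⊕ (Σ i, Fin (anc i))

/-- The agent that holds a given qubit. -/
def EPRNetwork.owner {n : ℕ} {ι : Type*} (N : EPRNetwork n ι) (anc : Fin n → ℕ) :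
    NetQubit ι anc → Fin n
  | Sum.inl (k, s) => N.endpoint k s
  | Sum.inr a => a.1

/-- The amplitudes of the EPR pair `(|00⟩ + |11⟩)/√2`. -/
def eprAmp (a b : Fin 2) : ℂ := if a = b then 1 / (Real.sqrt 2 : ℂ) else 0

/-- The initial state: every pair is an EPR pair, every ancilla is in the state `|0⟩`. -/
def initState {n : ℕ} (ι : Type*) [Fintype ι] (anc : Fin n → ℕ) : StateVec (NetQubit ι anc) :=
  fun x => (∏ k : ι, eprAmp (x (Sum.inl (k, 0))) (x (Sum.inl (k, 1)))) *
    ∏ a : (Σ i, Fin (anc i)), if x (Sum.inr a) = 0 then 1 else 0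

/-! ### Local operations and classical communication -/

/-- The qubits held by agent `i`. -/
abbrev Held {n : ℕ} {Q : Type*} (owner : Q → Fin n) (i : Fin n) := {q : Q // owner q = i}

/-- Operators on the qubits held by agent `i`. -/
abbrev LocalMatrix {n : ℕ} {Q : Type*} (owner : Q → Fin n) (i : Fin n) :=
  Matrix (Config (Held owner i)) (Config (Held owner i)) ℂ

/-- `(A ⊗ 1) ψ`, where `A` acts on the qubits held by agent `i`. -/
def applyLocal {n : ℕ} {Q : Type*} [Fintype Q] [DecidableEq Q] (owner : Q → Fin n) (i : Fin n)
    (A : LocalMatrix owner i) (ψ : StateVec Q) : StateVec Q := fun x =>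
  ∑ z : Config (Held owner i),
    A (fun q => x q) z * ψ (fun q => if h : owner q = i then z ⟨q, h⟩ else x q)

/-- One step of an LOCC protocol. What an agent does may depend only on her own view: the list of
the measurement outcomes she has obtained and the cbits she has received so far.

* `operate i r K _`: agent `i` applies to the qubits she holds a quantum operation with classical
  outcome `x : Fin r` and Kraus operators `K v x`, `v` being her view. (`r = 1`: a unitary.)
* `send i j f`: agent `i` sends the single cbit `f v` to agent `j`, `v` being the view of `i`. -/
inductive Step {n : ℕ} {Q : Type*} [Fintype Q] [DecidableEq Q] (owner : Q → Fin n)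
  | operate (i : Fin n) (r : ℕ) (K : List ℕ → Fin r → LocalMatrix owner i)
      (complete : ∀ v, ∑ x, (K v x).conjTranspose * K v x = 1) : Step owner
  | send (i j : Fin n) (f : List ℕ → Fin 2) : Step owner

/-- A branch of the execution: the state vector reached (not normalised: its squared norm is the
probability of the branch) and the views of the agents. -/
structure Branch (n : ℕ) (Q : Type*) where
  state : StateVec Q
  view : Fin n → List ℕ

/-- The branches that a step produces from a given branch. -/
def Step.next {n : ℕ} {Q : Type*} [Fintype Q] [DecidableEq Q] {owner : Q → Fin n} :
    Step owner → Branch n Q → List (Branch n Q)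
  | .operate i r K _, b => (List.finRange r).map fun x =>
      ⟨applyLocal owner i (K (b.view i) x) b.state,
        Function.update b.view i (b.view i ++ [(x : ℕ)])⟩
  | .send i j f, b =>
      [⟨b.state, Function.update b.view j (b.view j ++ [(f (b.view i) : ℕ)])⟩]

/-- The number of cbits that a step communicates. -/
def Step.cbits {n : ℕ} {Q : Type*} [Fintype Q] [DecidableEq Q] {owner : Q → Fin n} :
    Step owner → ℕ
  | .operate .. => 0
  | .send .. => 1

/-- All the branches at the end of a sequence of steps. -/
def runSteps {n : ℕ} {Q : Type*} [Fintype Q] [DecidableEq Q] {owner : Q → Fin n} :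
    List (Step owner) → Branch n Q → List (Branch n Q)
  | [], b => [b]
  | s :: p, b => (s.next b).flatMap (runSteps p)

/-- An LOCC protocol on a network of EPR pairs: a number of ancilla qubits for each agent, a finite
sequence of steps, and for each agent one of her qubits, which is to carry her share of the
state that is prepared. -/
structure Protocol {n : ℕ} {ι : Type*} [Fintype ι] [DecidableEq ι] (N : EPRNetwork n ι) where
  anc : Fin n → ℕ
  steps : List (Step (N.owner anc))
  out : Fin n → NetQubit ι anc
  owner_out : ∀ i, N.owner anc (out i) = i

/-- The branches at the end of the protocol. -/
def Protocol.outcomes {n : ℕ} {ι : Type*} [Fintype ι] [DecidableEq ι] {N : EPRNetwork n ι}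
    (P : Protocol N) : List (Branch n (NetQubit ι P.anc)) :=
  runSteps P.steps ⟨initState ι P.anc, fun _ => []⟩

/-- The protocol prepares the pure state `φ` with certainty: in every branch the output qubits are
in the state `φ`, in a product with some state `χ` of all the other qubits (`χ = 0` in branches of
probability zero). -/
def Protocol.Prepares {n : ℕ} {ι : Type*} [Fintype ι] [DecidableEq ι] {N : EPRNetwork n ι}
    (P : Protocol N) (φ : StateVec (Fin n)) : Prop :=
  ∀ b ∈ P.outcomes, ∃ χ : StateVec {q // q ∉ Set.range P.out},
    ∀ x, b.state x = φ (fun i => x (P.out i)) * χ (fun q => x q)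

/-- The total number of cbits communicated. A broadcast counts once for each recipient. -/
def Protocol.cbits {n : ℕ} {ι : Type*} [Fintype ι] [DecidableEq ι] {N : EPRNetwork n ι}
    (P : Protocol N) : ℕ :=
  (P.steps.map Step.cbits).sum

end LOCC

end

/-! Necessity. For a set `S` of agents, being a product vector across `S` and its complement is a
system of quadratic equations, ψ(x)ψ(y) = ψ(x')ψ(y'), where x', y' arise from x, y by exchanging the
parts off `S`. A Kraus operator acts on one side only and so preserves it
(`IsProductAcross.applyLocal`). If the EPR graph is disconnected, take a component for `S`: no pair
crosses the cut, so the initial state is a product, and so is every branch. Some branch is nonzero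
by completeness of the Kraus operators. Its output would make φ a product; undoing the local
unitaries would make the CAT state a product, which it is not.

Sufficiency. Every agent has one ancilla. A Hadamard gate at a root gives a one-agent CAT state,
which then grows along edges leaving the current set. To add `v` through an EPR pair shared with
`u`, agent `u` measures the parity of her ancilla and her half and sends the outcome `m`; the half
of `v` then carries the CAT bit shifted by `m`, and `v` removes the shift and moves the bit into her
ancilla (`leadsTo_linkSteps`). Each new agent costs one cbit, and the final local unitaries cost
none. The total is n - 1, which is at most 3n - 5 for n ≥ 2.

For a spanning tree, one pair per edge is kept and the same construction is run on the restricted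
network. -/

namespace LOCC

open Function

/-! ### Local operators, executions, and the product obstruction. -/

section General

variable {n : ℕ} {Q : Type*} {owner : Q → Fin n}

/-- Replace the part of a configuration that agent `i` holds. -/
def overrideAt (owner : Q → Fin n) (i : Fin n) (x : Config Q) (z : Config (Held owner i)) :
    Config Q :=
  fun q => if h : owner q = i then z ⟨q, h⟩ else x q

theorem overrideAt_held (i : Fin n) (x : Config Q) (z : Config (Held owner i)) :
    (fun q : Held owner i => overrideAt owner i x z q) = z := by
  funext q
  simp [overrideAt, q.2]

theorem overrideAt_overrideAt (i : Fin n) (x : Config Q) (z w : Config (Held owner i)) :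
    overrideAt owner i (overrideAt owner i x z) w = overrideAt owner i x w := by
  funext q
  by_cases h : owner q = i <;> simp [overrideAt, h]

theorem overrideAt_self (i : Fin n) (x : Config Q) :
    overrideAt owner i x (fun q => x q) = x := by
  funext q
  by_cases h : owner q = i <;> simp [overrideAt, h]

theorem overrideAt_update [DecidableEq Q] (i : Fin n) (x : Config Q) (w : Config (Held owner i))
    (b : Held owner i) (v : Fin 2) :
    overrideAt owner i x (update w b v) = update (overrideAt owner i x w) b v := by
  funext q
  by_cases hq : q = b
  · subst hq
    simp [overrideAt, b.2]
  · by_cases h : owner q = i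
    · have : (⟨q, h⟩ : Held owner i) ≠ b := fun e => hq (by rw [← e])
      simp [overrideAt, h, hq, this]
    · simp [overrideAt, h, hq]

variable [Fintype Q] [DecidableEq Q]

theorem applyLocal_apply (i : Fin n) (A : LocalMatrix owner i) (ψ : StateVec Q) (x : Config Q) :
    applyLocal owner i A ψ x = ∑ z, A (fun q => x q) z * ψ (overrideAt owner i x z) := rfl

theorem applyLocal_mul (i : Fin n) (A B : LocalMatrix owner i) (ψ : StateVec Q) :
    applyLocal owner i (A * B) ψ = applyLocal owner i A (applyLocal owner i B ψ) := by
  funext x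
  simp only [applyLocal_apply, overrideAt_held, overrideAt_overrideAt, Matrix.mul_apply,
    Finset.sum_mul, Finset.mul_sum]
  rw [Finset.sum_comm]
  simp only [mul_assoc]

theorem applyLocal_one (i : Fin n) (ψ : StateVec Q) :
    applyLocal owner i (1 : LocalMatrix owner i) ψ = ψ := by
  funext x
  simp [applyLocal_apply, Matrix.one_apply, overrideAt_self]

theorem applyLocal_sum {r : ℕ} (i : Fin n) (A : Fin r → LocalMatrix owner i) (ψ : StateVec Q) :
    applyLocal owner i (∑ k, A k) ψ = ∑ k, applyLocal owner i (A k) ψ := by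
  funext x
  simp only [applyLocal_apply, Finset.sum_apply, Matrix.sum_apply, Finset.sum_mul]
  rw [Finset.sum_comm]

theorem applyLocal_zero (i : Fin n) (A : LocalMatrix owner i) :
    applyLocal owner i A (0 : StateVec Q) = 0 := by
  funext x
  simp [applyLocal_apply]

theorem applyLocal_smul (i : Fin n) (A : LocalMatrix owner i) (c : ℂ) (ψ : StateVec Q) :
    applyLocal owner i A (c • ψ) = c • applyLocal owner i A ψ := by
  funext x
  simp only [applyLocal_apply, Pi.smul_apply, smul_eq_mul, Finset.mul_sum]
  exact Finset.sum_congr rfl fun z _ => by ring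

/-! ### Executions -/

theorem runSteps_append (p q : List (Step owner)) (b : Branch n Q) :
    runSteps (p ++ q) b = (runSteps p b).flatMap (runSteps q) := by
  induction p generalizing b with
  | nil => simp [runSteps]
  | cons s p ih => simp only [List.cons_append, runSteps, List.flatMap_assoc, funext ih]

/-- An execution that starts with a nonzero state has a branch of positive probability. -/
theorem exists_ne_zero_of_runSteps (p : List (Step owner)) (b : Branch n Q) (hb : b.state ≠ 0) :
    ∃ b' ∈ runSteps p b, b'.state ≠ 0 := by
  induction p generalizing b with
  | nil => exact ⟨b, by simp [runSteps], hb⟩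
  | cons s p ih =>
    obtain ⟨c, hc, hc0⟩ : ∃ c ∈ s.next b, c.state ≠ 0 := by
      cases s with
      | send i j f => exact ⟨_, List.mem_singleton_self _, hb⟩
      | operate i r K complete =>
        -- If every Kraus image vanished, then ψ = ∑ K†Kψ = 0.
        by_contra! h
        apply hb
        have h0 : ∀ x, applyLocal owner i (K (b.view i) x) b.state = 0 := fun x =>
          h _ (List.mem_map.2 ⟨x, List.mem_finRange x, rfl⟩)
        rw [← applyLocal_one (owner := owner) i b.state, ← complete (b.view i), applyLocal_sum]
        exact Finset.sum_eq_zero fun x _ => by rw [applyLocal_mul, h0, applyLocal_zero]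
    obtain ⟨b', hb', h⟩ := ih c hc0
    exact ⟨b', List.mem_flatMap.2 ⟨c, hc, hb'⟩, h⟩

/-! ### States that are a product across a bipartition -/

open Classical in
/-- The configuration that agrees with `x` on `S` and with `y` off `S`. -/
noncomputable def mix {R : Type*} (S : Set R) (x y : Config R) : Config R :=
  fun q => if q ∈ S then x q else y q

/-- The vector `ψ` is a product of a vector on `S` and a vector on the complement of `S`. -/
def IsProductAcross {R : Type*} (S : Set R) (ψ : StateVec R) : Prop :=
  ∀ x y, ψ x * ψ y = ψ (mix S x y) * ψ (mix S y x)

theorem mix_mix_left {R : Type*} (S : Set R) (x y : Config R) :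
    mix S (mix S x y) (mix S y x) = x := by
  funext q
  by_cases h : q ∈ S <;> simp [mix, h]

/-- All qubits of agent `i` lie on one side of the cut, so after expanding both sides into double
sums the identity for ψ applies term by term. -/
theorem IsProductAcross.applyLocal {ψ : StateVec Q} {S : Set (Fin n)}
    (h : IsProductAcross (owner ⁻¹' S) ψ) (i : Fin n) (A : LocalMatrix owner i) :
    IsProductAcross (owner ⁻¹' S) (applyLocal owner i A ψ) := by
  intro x y
  simp only [applyLocal_apply, Finset.sum_mul_sum]
  by_cases hi : i ∈ S
  · refine Finset.sum_congr rfl fun z _ => Finset.sum_congr rfl fun w _ => ?_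
    have e : ∀ x y z w, mix (owner ⁻¹' S) (overrideAt owner i x z) (overrideAt owner i y w) =
        overrideAt owner i (mix (owner ⁻¹' S) x y) z := by
      intro x y z w
      funext q
      by_cases h : owner q = i
      · simp [mix, overrideAt, h, hi]
      · simp [mix, overrideAt, h]
    have r : ∀ x y, (fun q : Held owner i => mix (owner ⁻¹' S) x y q) =
        fun q : Held owner i => x q := by
      intro x y
      funext q
      simp [mix, q.2, hi]
    have := h (overrideAt owner i x z) (overrideAt owner i y w)
    rw [e, e] at this
    rw [r, r]
    linear_combination A (fun q : Held owner i => x q) z * A (fun q : Held owner i => y q) w * this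
  -- Off `S` the mixing exchanges what `i` holds in the two configurations, so the two summation
  -- variables trade places.
  · rw [Finset.sum_comm]
    refine Finset.sum_congr rfl fun w _ => Finset.sum_congr rfl fun z _ => ?_
    have e : ∀ x y z w, mix (owner ⁻¹' S) (overrideAt owner i x z) (overrideAt owner i y w) =
        overrideAt owner i (mix (owner ⁻¹' S) x y) w := by
      intro x y z w
      funext q
      by_cases h : owner q = i
      · simp [mix, overrideAt, h, hi]
      · simp [mix, overrideAt, h]
    have r : ∀ x y, (fun q : Held owner i => mix (owner ⁻¹' S) x y q) =
        fun q : Held owner i => y q := by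
      intro x y
      funext q
      simp [mix, q.2, hi]
    have := h (overrideAt owner i x z) (overrideAt owner i y w)
    rw [e, e] at this
    rw [r, r]
    linear_combination A (fun q : Held owner i => x q) z * A (fun q : Held owner i => y q) w * this

theorem IsProductAcross.runSteps {S : Set (Fin n)} (p : List (Step owner)) (b : Branch n Q)
    (hb : IsProductAcross (owner ⁻¹' S) b.state) :
    ∀ b' ∈ runSteps p b, IsProductAcross (owner ⁻¹' S) b'.state := by
  induction p generalizing b with
  | nil => simpa [LOCC.runSteps] using hb
  | cons s p ih =>
    intro b' hb'
    obtain ⟨c, hc, hb'⟩ := List.mem_flatMap.1 hb'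
    refine ih c ?_ b' hb'
    cases s with
    | send i j f =>
      rw [List.mem_singleton.1 hc]
      exact hb
    | operate i r K complete =>
      obtain ⟨x, -, rfl⟩ := List.mem_map.1 hc
      exact hb.applyLocal i _

theorem IsProductAcross.mul {R : Type*} {S : Set R} {ψ χ : StateVec R}
    (h : IsProductAcross S ψ) (h' : IsProductAcross S χ) :
    IsProductAcross S fun x => ψ x * χ x := by
  intro x y
  linear_combination χ x * χ y * h x y + ψ (mix S x y) * ψ (mix S y x) * h' x y

theorem IsProductAcross.prod {R κ : Type*} {S : Set R} (s : Finset κ) {ψ : κ → StateVec R}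
    (h : ∀ k, IsProductAcross S (ψ k)) : IsProductAcross S fun x => ∏ k ∈ s, ψ k x := by
  intro x y
  rw [← Finset.prod_mul_distrib, ← Finset.prod_mul_distrib]
  exact Finset.prod_congr rfl fun k _ => h k x y

/-- Each factor of the initial state, a pair or an ancilla, lives entirely on one side of the cut.
-/
theorem isProductAcross_initState {ι : Type*} [Fintype ι] (N : EPRNetwork n ι) (anc : Fin n → ℕ)
    (S : Set (Fin n)) (hS : ∀ k, N.endpoint k 0 ∈ S ↔ N.endpoint k 1 ∈ S) :
    IsProductAcross (N.owner anc ⁻¹' S) (initState ι anc) := by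
  refine IsProductAcross.mul (IsProductAcross.prod _ fun k x y => ?_)
    (IsProductAcross.prod _ fun a x y => ?_)
  · by_cases h : N.endpoint k 1 ∈ S
    · have h' := (hS k).2 h
      simp [mix, EPRNetwork.owner, h, h']
    · have h' := mt (hS k).1 h
      simp only [mix, EPRNetwork.owner, h, h', Set.mem_preimage, if_false]
      ring
  · by_cases h : a.1 ∈ S
    · simp [mix, EPRNetwork.owner, h]
    · simp only [mix, EPRNetwork.owner, h, Set.mem_preimage, if_false]
      ring

theorem initState_ne_zero {ι : Type*} [Fintype ι] (anc : Fin n → ℕ) : initState ι anc ≠ 0 := by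
  intro h
  have := congrFun h 0
  simp [initState, eprAmp] at this

/-! ### Products of one-qubit operators -/

/-- The operator `V₁ ⊗ ⋯ ⊗ Vₙ`. -/
def tensorApply (V : Fin n → Matrix (Fin 2) (Fin 2) ℂ) (g : StateVec (Fin n)) :
    StateVec (Fin n) :=
  fun x => ∑ y : Config (Fin n), (∏ i, V i (x i) (y i)) * g y

theorem tensorApply_tensorApply (V W : Fin n → Matrix (Fin 2) (Fin 2) ℂ) (g : StateVec (Fin n)) :
    tensorApply V (tensorApply W g) = tensorApply (fun i => V i * W i) g := by
  funext x
  simp only [tensorApply, Matrix.mul_apply, Finset.mul_sum]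
  rw [Finset.sum_comm]
  refine Finset.sum_congr rfl fun z _ => ?_
  rw [Finset.prod_univ_sum, Finset.sum_mul, Fintype.piFinset_univ]
  refine Finset.sum_congr rfl fun y _ => ?_
  rw [Finset.prod_mul_distrib]
  ring

theorem tensorApply_one (g : StateVec (Fin n)) : tensorApply (fun _ => 1) g = g := by
  funext x
  simp only [tensorApply, Matrix.one_apply, Finset.prod_ite_zero, Finset.prod_const_one]
  rw [Finset.sum_eq_single x]
  · simp
  · intro y _ hy
    rw [if_neg (fun h => hy (funext fun i => (h i (Finset.mem_univ i)).symm)), zero_mul]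
  · simp

theorem IsProductAcross.tensorApply {S : Set (Fin n)} {g : StateVec (Fin n)}
    (h : IsProductAcross S g) (V : Fin n → Matrix (Fin 2) (Fin 2) ℂ) :
    IsProductAcross S (tensorApply V g) := by
  intro a b
  simp only [LOCC.tensorApply, Finset.sum_mul_sum, ← Finset.sum_product', Finset.univ_product_univ]
  let σ : Config (Fin n) × Config (Fin n) → Config (Fin n) × Config (Fin n) :=
    fun p => (mix S p.1 p.2, mix S p.2 p.1)
  -- The mixing acts on the pair of summation variables as an involution, which reindexes the double
  -- sum.
  have hσ : Function.Involutive σ := fun p => Prod.ext (mix_mix_left _ _ _) (mix_mix_left _ _ _)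
  refine Fintype.sum_equiv hσ.toPerm _ _ fun p => ?_
  have hV : (∏ i, V i (a i) (p.1 i)) * ∏ i, V i (b i) (p.2 i) =
      (∏ i, V i (mix S a b i) (mix S p.1 p.2 i)) * ∏ i, V i (mix S b a i) (mix S p.2 p.1 i) := by
    rw [← Finset.prod_mul_distrib, ← Finset.prod_mul_distrib]
    refine Finset.prod_congr rfl fun i _ => ?_
    by_cases hi : i ∈ S
    · simp [mix, hi]
    · simp only [mix, hi, if_false]
      ring
  have hg := h p.1 p.2
  simp only [Function.Involutive.coe_toPerm, σ]
  linear_combination (∏ i, V i (a i) (p.1 i)) * (∏ i, V i (b i) (p.2 i)) * hg +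
    g (mix S p.1 p.2) * g (mix S p.2 p.1) * hV

theorem not_isProductAcross_catState {S : Set (Fin n)} (h₁ : S.Nonempty) (h₂ : Sᶜ.Nonempty) :
    ¬ IsProductAcross S (catState n) := by
  intro h
  obtain ⟨i, hi⟩ := h₁
  obtain ⟨j, hj⟩ := h₂
  rw [Set.mem_compl_iff] at hj
  -- Mixing the all-zero and all-one strings gives strings of amplitude zero, while both originals
  -- have nonzero amplitude.
  have e := h 0 1
  have z : catState n (mix S 0 1) = 0 := by
    have a : ¬ ∀ k, mix S (0 : Config (Fin n)) 1 k = 0 := fun H => by simpa [mix, hj] using H j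
    have b : ¬ ∀ k, mix S (0 : Config (Fin n)) 1 k = 1 := fun H => by simpa [mix, hi] using H i
    simp only [catState, if_neg a, if_neg b]
    simp
  have : Nonempty (Fin n) := ⟨i⟩
  rw [z, zero_mul] at e
  simp [catState] at e

theorem not_isProductAcross_of_isMaxEntangled {φ : StateVec (Fin n)} (hφ : IsMaxEntangled φ)
    {S : Set (Fin n)} (h₁ : S.Nonempty) (h₂ : Sᶜ.Nonempty) : ¬ IsProductAcross S φ := by
  obtain ⟨U, hU, hφ⟩ := hφ
  intro h
  apply not_isProductAcross_catState h₁ h₂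
  have e : φ = tensorApply U (catState n) := funext hφ
  have := h.tensorApply fun i => star (U i)
  have hone : (fun i => star (U i) * U i) = fun _ => 1 :=
    funext fun i => (Matrix.mem_unitaryGroup_iff'.1 (hU i))
  rwa [e, tensorApply_tensorApply, hone, tensorApply_one] at this

/-- A maximally entangled state can only be prepared if no bipartition of the agents separates
the EPR pairs. -/
theorem EPRNetwork.connected_of_prepares {ι : Type*} [Fintype ι] [DecidableEq ι] (hn : 0 < n)
    {N : EPRNetwork n ι} {φ : StateVec (Fin n)} (hφ : IsMaxEntangled φ) (P : Protocol N)
    (hP : P.Prepares φ) : N.eprGraph.Connected := by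
  have : Nonempty (Fin n) := ⟨⟨0, hn⟩⟩
  rw [SimpleGraph.connected_iff]
  refine ⟨fun u v => ?_, inferInstance⟩
  by_contra huv
  let S : Set (Fin n) := {w | N.eprGraph.Reachable u w}
  have hS : ∀ k, N.endpoint k 0 ∈ S ↔ N.endpoint k 1 ∈ S := by
    intro k
    have hadj : N.eprGraph.Adj (N.endpoint k 0) (N.endpoint k 1) :=
      ⟨N.endpoint_ne k, Or.inl ⟨k, rfl, rfl⟩⟩
    exact ⟨fun h => h.trans hadj.reachable, fun h => h.trans hadj.symm.reachable⟩
  obtain ⟨b, hb, hb0⟩ := exists_ne_zero_of_runSteps P.steps ⟨initState ι P.anc, fun _ => []⟩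
    (initState_ne_zero P.anc)
  have hprod := IsProductAcross.runSteps P.steps ⟨initState ι P.anc, fun _ => []⟩
    (isProductAcross_initState N P.anc S hS) b hb
  obtain ⟨χ, hχ⟩ := hP b hb
  -- The non-output qubits are frozen at `x₀`, where χ does not vanish; the common factor χ(x₀)²
  -- cancels at the end and leaves the product identity for φ.
  obtain ⟨x₀, hx₀⟩ := Function.ne_iff.1 hb0
  rw [hχ] at hx₀
  have hχ0 := right_ne_zero_of_mul hx₀
  refine not_isProductAcross_of_isMaxEntangled hφ (S := S) ⟨u, .refl u⟩ ⟨v, huv⟩ fun a c => ?_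
  have hinj : Function.Injective P.out := fun i j h => by
    rw [← P.owner_out i, h, P.owner_out]
  let ext : Config (Fin n) → Config (NetQubit ι P.anc) := fun a => Function.extend P.out a x₀
  have ext_out : ∀ a i, ext a (P.out i) = a i := fun a i => hinj.extend_apply a x₀ i
  have ext_rest : ∀ a (q : {q // q ∉ Set.range P.out}), ext a q = x₀ q := fun a q =>
    Function.extend_apply' a x₀ q q.2
  have h := hprod (ext a) (ext c)
  have mo : ∀ a c i, mix (N.owner P.anc ⁻¹' S) (ext a) (ext c) (P.out i) = mix S a c i := by
    intro a c i
    have : P.out i ∈ N.owner P.anc ⁻¹' S ↔ i ∈ S := by rw [Set.mem_preimage, P.owner_out]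
    by_cases hi : i ∈ S
    · rw [mix, mix, if_pos (this.2 hi), if_pos hi, ext_out]
    · rw [mix, mix, if_neg (mt this.1 hi), if_neg hi, ext_out]
  have mr : ∀ a c, ∀ q : {q // q ∉ Set.range P.out},
      mix (N.owner P.anc ⁻¹' S) (ext a) (ext c) q = x₀ q := by
    intro a c q
    simp [mix, ext_rest]
  simp only [hχ, ext_out, ext_rest, mo, mr] at h
  have h2 : χ (fun q => x₀ q) * χ (fun q => x₀ q) ≠ 0 := mul_ne_zero hχ0 hχ0
  apply mul_right_cancel₀ h2
  linear_combination h

end General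
-- The local operations of the protocol and their action on states.
section LocalOperations

variable {n : ℕ} {Q : Type*} {owner : Q → Fin n} [Fintype Q] [DecidableEq Q]

open Classical in
/-- The operator that maps `|g w⟩` to `|w⟩` for the configurations `w` that satisfy `p`. -/
noncomputable def gatherMatrix {i : Fin n} (p : Config (Held owner i) → Prop)
    (g : Config (Held owner i) → Config (Held owner i)) : LocalMatrix owner i :=
  fun w z => if p w ∧ z = g w then 1 else 0

open Classical in
theorem applyLocal_gatherMatrix {i : Fin n} (p : Config (Held owner i) → Prop)
    (g : Config (Held owner i) → Config (Held owner i)) (ψ : StateVec Q) (x : Config Q) :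
    applyLocal owner i (gatherMatrix p g) ψ x =
      if p (fun q => x q) then ψ (overrideAt owner i x (g fun q => x q)) else 0 := by
  rw [applyLocal_apply]
  by_cases h : p (fun q => x q) <;> simp [gatherMatrix, h]

/-- The hypothesis says that each basis label `z` is used by exactly one outcome and one target, so
the operators together permute basis vectors into orthogonal slots. -/
theorem gatherMatrix_complete {i : Fin n} {r : ℕ} (p : Fin r → Config (Held owner i) → Prop)
    (g : Fin r → Config (Held owner i) → Config (Held owner i))
    (h : ∀ z, ∃ m w, (p m w ∧ z = g m w) ∧ ∀ m' w', p m' w' → z = g m' w' → m' = m ∧ w' = w) :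
    ∑ m, (gatherMatrix (p m) (g m)).conjTranspose * gatherMatrix (p m) (g m) = 1 := by
  classical
  ext z z'
  simp only [Matrix.sum_apply, Matrix.mul_apply, Matrix.conjTranspose_apply, Matrix.one_apply,
    gatherMatrix]
  obtain ⟨m, w, ⟨hp, hz⟩, hu⟩ := h z
  rw [Finset.sum_eq_single m, Finset.sum_eq_single w]
  · rw [if_pos ⟨hp, hz⟩, ← hz]
    simp [hp, eq_comm]
  · intro w' _ hw'
    rw [if_neg fun e => hw' (hu m w' e.1 e.2).2]
    simp
  · simp
  · intro m' _ hm'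
    refine Finset.sum_eq_zero fun w' _ => ?_
    rw [if_neg fun e => hm' (hu m' w' e.1 e.2).1]
    simp
  · simp

/-- The Kraus operator of outcome `m` of a measurement of the parity of the qubits `a` and `b`,
after which `b` is reset to `0`. -/
noncomputable def parityKraus {i : Fin n} (a b : Held owner i) (m : Fin 2) :
    LocalMatrix owner i :=
  gatherMatrix (fun w => w b = 0) fun w => update w b (w a + m)

theorem parityKraus_complete {i : Fin n} {a b : Held owner i} (hab : a ≠ b) :
    ∑ m, (parityKraus a b m).conjTranspose * parityKraus a b m = 1 := by
  -- The outcome is the parity of the two bits, with arithmetic in `Fin 2`.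
  refine gatherMatrix_complete _ _ fun z => ⟨z b - z a, update z b 0, ⟨by simp, ?_⟩, ?_⟩
  · simp [update_of_ne hab]
  · rintro m' w' h1 rfl
    constructor
    · simp [update_of_ne hab]
    · simp [← h1]

theorem applyLocal_parityKraus {i : Fin n} (a b : Held owner i) (m : Fin 2) (ψ : StateVec Q)
    (x : Config Q) :
    applyLocal owner i (parityKraus a b m) ψ x =
      if x b = 0 then ψ (update x b (x a + m)) else 0 := by
  rw [parityKraus, applyLocal_gatherMatrix, overrideAt_update, overrideAt_self]
  congr

/-- The unitary `|0, t⟩ ↦ |t + m, 0⟩`, `|1, t⟩ ↦ |t + m + 1, 1⟩` on the qubits `a` and `t`. -/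
noncomputable def receiveMatrix {i : Fin n} (a t : Held owner i) (m : Fin 2) :
    LocalMatrix owner i :=
  gatherMatrix (fun _ => True) fun w => update (update w a (w t)) t (w a + w t + m)

theorem receiveMatrix_complete {i : Fin n} {a t : Held owner i} (hat : a ≠ t) (m : Fin 2) :
    ∑ _x : Fin 1, (receiveMatrix a t m).conjTranspose * receiveMatrix a t m = 1 := by
  have cancel₁ : ∀ x y z : Fin 2, x = x - y - z + y + z := by decide
  have cancel₂ : ∀ x y z : Fin 2, x = x + y + z - y - z := by decide
  -- The witness inverts the relabelling: the new `t` is the old `a`, and the new `a` is the old `t`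
  -- corrected by the old `a` and by `m`.
  refine gatherMatrix_complete (fun _ _ => True) _ fun z =>
    ⟨0, update (update z t (z a)) a (z t - z a - m), ⟨trivial, ?_⟩, ?_⟩
  · funext q
    by_cases h1 : q = t
    · subst h1
      simpa [hat.symm] using cancel₁ _ _ _
    · by_cases h2 : q = a
      · subst h2
        simp [hat, hat.symm]
      · simp [h1, h2]
  · rintro m' w' - rfl
    refine ⟨Subsingleton.elim _ _, ?_⟩
    funext q
    by_cases h1 : q = a
    · subst h1
      simpa [hat] using cancel₂ _ _ _
    · by_cases h2 : q = t
      · subst h2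
        simp [hat, hat.symm]
      · simp [h1, h2]

theorem applyLocal_receiveMatrix {i : Fin n} (a t : Held owner i) (m : Fin 2) (ψ : StateVec Q)
    (x : Config Q) :
    applyLocal owner i (receiveMatrix a t m) ψ x =
      ψ (update (update x a (x t)) t (x a + x t + m)) := by
  rw [receiveMatrix, applyLocal_gatherMatrix, overrideAt_update, overrideAt_update,
    overrideAt_self]
  simp

/-- The operator `V` on the qubit `a`. -/
def qubitMatrix {i : Fin n} (a : Held owner i) (V : Matrix (Fin 2) (Fin 2) ℂ) :
    LocalMatrix owner i :=
  fun w z => if z = update w a (z a) then V (w a) (z a) else 0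

/-- The condition leaves only the bit at `a` free. -/
theorem sum_eq_update {R : Type*} [Fintype R] [DecidableEq R] (w : Config R) (a : R)
    (f : Config R → ℂ) :
    ∑ z, (if z = update w a (z a) then f z else 0) = ∑ s, f (update w a s) := by
  rw [← Finset.sum_filter]
  refine Finset.sum_bij' (fun z _ => z a) (fun s _ => update w a s) ?_ ?_ ?_ ?_ ?_
  · simp
  · simp
  · intro z hz
    exact (Finset.mem_filter.1 hz).2.symm
  · simp
  · intro z hz
    rw [← (Finset.mem_filter.1 hz).2]

theorem applyLocal_qubitMatrix {i : Fin n} (a : Held owner i) (V : Matrix (Fin 2) (Fin 2) ℂ)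
    (ψ : StateVec Q) (x : Config Q) :
    applyLocal owner i (qubitMatrix a V) ψ x = ∑ s, V (x a) s * ψ (update x a s) := by
  simp only [applyLocal_apply, qubitMatrix, ite_mul, zero_mul]
  rw [sum_eq_update]
  simp [overrideAt_update, overrideAt_self]

theorem qubitMatrix_complete {i : Fin n} (a : Held owner i) {V : Matrix (Fin 2) (Fin 2) ℂ}
    (hV : V ∈ Matrix.unitaryGroup (Fin 2) ℂ) :
    ∑ _x : Fin 1, (qubitMatrix a V).conjTranspose * qubitMatrix a V = 1 := by
  have hV' := Matrix.mem_unitaryGroup_iff'.1 hV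
  ext z z'
  have key : ∀ w, star (qubitMatrix a V w z) * qubitMatrix a V w z' =
      if w = update z a (w a) then
        (if z' = update z a (z' a) then star (V (w a) (z a)) * V (w a) (z' a) else 0) else 0 := by
    intro w
    by_cases h : w = update z a (w a)
    · have h1 : z = update w a (z a) := by
        rw [h]
        simp
      have h2 : (z' = update w a (z' a)) ↔ z' = update z a (z' a) := by
        rw [h]
        simp
      simp only [qubitMatrix, if_pos h, if_pos h1, h2, mul_ite, mul_zero]
    · have h1 : ¬ z = update w a (z a) := by
        intro e
        apply h
        rw [e]
        simp
      simp only [qubitMatrix, if_neg h, if_neg h1, star_zero, zero_mul]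
  simp only [Finset.univ_unique, Finset.sum_singleton, Matrix.mul_apply,
    Matrix.conjTranspose_apply, key]
  rw [sum_eq_update z a fun w => if z' = update z a (z' a) then
    star (V (w a) (z a)) * V (w a) (z' a) else 0]
  have e := congrFun (congrFun hV' (z a)) (z' a)
  simp only [Matrix.mul_apply, Matrix.star_apply, Matrix.one_apply] at e
  by_cases h : z' = update z a (z' a)
  · simp only [if_pos h, update_self]
    rw [e, Matrix.one_apply]
    by_cases h' : z a = z' a
    · rw [if_pos h', if_pos]
      rw [h, ← h', update_eq_self]
    · rw [if_neg h', if_neg fun h'' => h' (congrFun h'' a)]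
  · simp only [if_neg h, Finset.sum_const_zero]
    rw [Matrix.one_apply, if_neg]
    rintro rfl
    simp at h

/-! ### Steps that lead to a known state -/

/-- The steps `p` turn every branch in the state `ψ` into branches in states proportional to `ψ'`. -/
def LeadsTo (p : List (Step owner)) (ψ ψ' : StateVec Q) : Prop :=
  ∀ b : Branch n Q, (∃ c : ℂ, b.state = c • ψ) →
    ∀ b' ∈ runSteps p b, ∃ c : ℂ, b'.state = c • ψ'

theorem LeadsTo.append {p q : List (Step owner)} {ψ ψ' ψ'' : StateVec Q}
    (h : LeadsTo p ψ ψ') (h' : LeadsTo q ψ' ψ'') : LeadsTo (p ++ q) ψ ψ'' := by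
  intro b hb b' hb'
  rw [runSteps_append] at hb'
  obtain ⟨c, hc, hb'⟩ := List.mem_flatMap.1 hb'
  exact h' c (h b hb c hc) b' hb'

theorem LeadsTo.nil (ψ : StateVec Q) : LeadsTo (owner := owner) [] ψ ψ := by
  intro b hb b' hb'
  rwa [List.mem_singleton.1 hb']

/-- A unitary `V` on the qubit `a` of agent `i`. -/
def qubitStep (i : Fin n) (a : Held owner i) (V : Matrix (Fin 2) (Fin 2) ℂ)
    (hV : V ∈ Matrix.unitaryGroup (Fin 2) ℂ) : Step owner :=
  .operate i 1 (fun _ _ => qubitMatrix a V) fun _ => qubitMatrix_complete a hV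

theorem leadsTo_qubitStep (i : Fin n) (a : Held owner i) {V : Matrix (Fin 2) (Fin 2) ℂ}
    (hV : V ∈ Matrix.unitaryGroup (Fin 2) ℂ) (ψ : StateVec Q) :
    LeadsTo [qubitStep i a V hV] ψ fun x => ∑ s, V (x a) s * ψ (update x a s) := by
  rintro b ⟨c, hc⟩ b' hb'
  obtain ⟨b₁, hb₁, hb'⟩ := List.mem_flatMap.1 hb'
  obtain ⟨x, -, rfl⟩ := List.mem_map.1 hb₁
  rw [List.mem_singleton.1 hb']
  refine ⟨c, ?_⟩
  simp only [hc, applyLocal_smul]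
  congr 1
  exact funext fun x => applyLocal_qubitMatrix a V ψ x

/-- The bit that a view ends with. -/
def lastBit (v : List ℕ) : Fin 2 := Fin.ofNat 2 (v.getLastD 0)

theorem lastBit_append (v : List ℕ) (m : Fin 2) : lastBit (v ++ [(m : ℕ)]) = m := by
  simp [lastBit]

/-- Agent `u` measures the parity of her qubits `a` and `b` and sends the outcome to agent `v`, who
applies the corresponding unitary to her qubits `a'` and `t`. -/
noncomputable def relaySteps {u v : Fin n} {a b : Held owner u} {a' t : Held owner v}
    (hab : a ≠ b) (hat : a' ≠ t) : List (Step owner) :=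
  [.operate u 2 (fun _ => parityKraus a b) (fun _ => parityKraus_complete hab),
    .send u v lastBit,
    .operate v 1 (fun w _ => receiveMatrix a' t (lastBit w))
      (fun w => receiveMatrix_complete hat (lastBit w))]

theorem leadsTo_relaySteps {u v : Fin n} {a b : Held owner u} {a' t : Held owner v}
    (hab : a ≠ b) (hat : a' ≠ t) {ψ ψ' : StateVec Q}
    (h : ∀ m : Fin 2, ∃ c : ℂ, applyLocal owner v (receiveMatrix a' t m)
      (applyLocal owner u (parityKraus a b m) ψ) = c • ψ') :
    LeadsTo (relaySteps hab hat) ψ ψ' := by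
  rintro b₀ ⟨c, hc⟩ b' hb'
  obtain ⟨b₁, hb₁, hb'⟩ := List.mem_flatMap.1 hb'
  obtain ⟨m, -, rfl⟩ := List.mem_map.1 hb₁
  obtain ⟨b₂, hb₂, hb'⟩ := List.mem_flatMap.1 hb'
  rw [List.mem_singleton.1 hb₂] at hb'
  obtain ⟨b₃, hb₃, hb'⟩ := List.mem_flatMap.1 hb'
  obtain ⟨y, -, rfl⟩ := List.mem_map.1 hb₃
  rw [List.mem_singleton.1 hb']
  obtain ⟨d, hd⟩ := h m
  refine ⟨c * d, ?_⟩
  simp only [hc, applyLocal_smul, update_self, lastBit_append, hd, smul_smul]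

end LocalOperations
-- Growing a CAT state along EPR pairs.
section Cluster

variable {n : ℕ}

/-- The (unnormalised) state in which the agents in `S` share a CAT state and the other agents
hold `0`. -/
def partialCat (S : Finset (Fin n)) : StateVec (Fin n) :=
  fun a => ∑ c : Fin 2, if ∀ i, a i = if i ∈ S then c else 0 then 1 else 0

theorem catState_eq_smul : catState n = (1 / (Real.sqrt 2 : ℂ)) • partialCat Finset.univ := by
  funext x
  simp only [catState, partialCat, Fin.sum_univ_two, Finset.mem_univ, if_true, Pi.smul_apply,
    smul_eq_mul]
  ring

theorem partialCat_empty (a : Config (Fin n)) :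
    partialCat ∅ a = if ∀ i, a i = 0 then 2 else 0 := by
  simp only [partialCat, Finset.notMem_empty, if_false, Fin.sum_univ_two]
  split_ifs <;> norm_num

/-- Only the input bit 0 contributes. The factor 2 appears because the two terms of `partialCat ∅`
coincide. -/
theorem sum_mul_partialCat_empty_update (f : Fin 2 → ℂ) (r : Fin n) (a : Config (Fin n)) :
    ∑ s : Fin 2, f s * partialCat ∅ (update a r s) = 2 * f 0 * partialCat {r} a := by
  have h : ∀ s : Fin 2, (∀ i, update a r s i = 0) ↔ s = 0 ∧ ∀ i, i ≠ r → a i = 0 := by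
    intro s
    rw [forall_update_iff a fun _ b => b = 0]
  have h' : ∀ c : Fin 2, (∀ i, a i = if i ∈ ({r} : Finset (Fin n)) then c else 0) ↔
      c = a r ∧ ∀ i, i ≠ r → a i = 0 := by
    intro c
    constructor
    · intro H
      exact ⟨by simpa using (H r).symm, fun i hi => by simpa [hi] using H i⟩
    · rintro ⟨rfl, H⟩ i
      by_cases hi : i = r
      · simp [hi]
      · simpa [hi] using H i hi
  simp only [partialCat_empty, h]
  simp only [partialCat, h']
  by_cases H : ∀ i, i ≠ r → a i = 0
  · simp only [eq_true H, and_true]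
    simp [mul_comm]
  · simp [H]

/-- The amplitude identity behind a link: the old ancilla of `v ∉ S` must be 0, which forces `t =
0`, and the perfect correlation of the pair then makes the bit of `v` a copy of the bit of `u`. -/
theorem partialCat_insert {S : Finset (Fin n)} {u v : Fin n} (hu : u ∈ S) (hv : v ∉ S)
    (a : Config (Fin n)) (t : Fin 2) :
    partialCat S (update a v t) * (if a u = a v + t then 1 else 0) =
      partialCat (insert v S) a * if t = 0 then 1 else 0 := by
  have huv : u ≠ v := fun h => hv (h ▸ hu)
  simp only [partialCat, Finset.sum_mul]
  refine Finset.sum_congr rfl fun c _ => ?_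
  rw [ite_zero_mul_ite_zero, ite_zero_mul_ite_zero]
  congr 1
  rw [eq_iff_iff, forall_update_iff a fun i b => b = if i ∈ S then c else 0]
  constructor
  · rintro ⟨⟨ht, h⟩, h'⟩
    rw [if_neg hv] at ht
    subst ht
    refine ⟨fun i => ?_, rfl⟩
    by_cases hi : i = v
    · subst hi
      rw [if_pos (Finset.mem_insert_self _ _)]
      have := h u huv
      rw [if_pos hu, h', add_zero] at this
      exact this
    · rw [h i hi]
      simp [hi]
  · rintro ⟨h, rfl⟩
    refine ⟨⟨(if_neg hv).symm, fun i hi => ?_⟩, ?_⟩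
    · rw [h i]
      simp [hi]
    · rw [h u, h v]
      simp [hu]

variable {ι : Type*}

/-- The ancilla of agent `i`, each agent having one. -/
abbrev ancilla (ι : Type*) (i : Fin n) : NetQubit ι (fun _ : Fin n => 1) := Sum.inr ⟨i, 0⟩

/-- The ancilla of agent `i` as a qubit that she holds. -/
def heldAncilla (N : EPRNetwork n ι) (i : Fin n) : Held (N.owner fun _ => 1) i := ⟨ancilla ι i, rfl⟩

/-- A half of an EPR pair as a qubit that its holder holds. -/
def heldHalf (N : EPRNetwork n ι) (k : ι) (s : Fin 2) {i : Fin n} (h : N.endpoint k s = i) :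
    Held (N.owner fun _ => 1) i := ⟨Sum.inl (k, s), h⟩

theorem heldAncilla_ne_heldHalf (N : EPRNetwork n ι) (k : ι) (s : Fin 2) {i : Fin n} (h : N.endpoint k s = i) :
    heldAncilla N i ≠ heldHalf N k s h := fun e => by
  simpa [heldAncilla, heldHalf] using congrArg Subtype.val e

variable [DecidableEq ι]

/-- The amplitudes of a pair: an EPR pair if it is fresh, `|00⟩` if it has been used. -/
noncomputable def pairAmp (F : Finset ι) (k : ι) (a b : Fin 2) : ℂ :=
  if k ∈ F then (if a = 0 ∧ b = 0 then 1 else 0) else eprAmp a b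

theorem config_update_ancilla (x : Config (NetQubit ι (fun _ : Fin n => 1))) (i : Fin n)
    (s : Fin 2) :
    (fun j => update x (ancilla ι i) s (ancilla ι j)) = update (fun j => x (ancilla ι j)) i s := by
  funext j
  by_cases h : j = i
  · subst h
    simp
  · have : ancilla ι j ≠ ancilla ι i := fun e => h (by simpa [ancilla] using e)
    rw [update_of_ne this, update_of_ne h]

theorem pairAmp_eq_indicator {F : Finset ι} {k : ι} (hk : k ∉ F) (a b : Fin 2) :
    pairAmp F k a b = (1 / (Real.sqrt 2 : ℂ)) * if a = b then 1 else 0 := by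
  simp [pairAmp, hk, eprAmp]

theorem EPRNetwork.exists_restrict_eq (N : EPRNetwork n ι) (T : SimpleGraph (Fin n)) (hT : T ≤ N.eprGraph)
    (hT' : T.IsTree) : ∃ s : Finset ι, s.card = n - 1 ∧ (N.restrict s).eprGraph = T := by
  classical
  have h : ∀ e : T.edgeSet, ∃ k, s(N.endpoint k 0, N.endpoint k 1) = (e : Sym2 (Fin n)) := by
    rintro ⟨e, he⟩
    induction e with
    | h a b =>
      obtain ⟨-, ⟨k, h0, h1⟩ | ⟨k, h0, h1⟩⟩ := hT he
      · exact ⟨k, by rw [h0, h1]⟩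
      · exact ⟨k, by rw [h0, h1, Sym2.eq_swap]⟩
  choose f hf using h
  -- A pair determines its edge, so distinct edges receive distinct pairs.
  have hinj : Injective f := fun e e' h => Subtype.ext (by rw [← hf e, h, hf e'])
  refine ⟨Finset.univ.image f, ?_, ?_⟩
  · rw [Finset.card_image_of_injective _ hinj, Finset.card_univ, SimpleGraph.card_edgeSet]
    have := hT'.card_edgeFinset
    rw [Fintype.card_fin] at this
    omega
  · have hadj : ∀ k : {k // k ∈ Finset.univ.image f}, T.Adj (N.endpoint k 0) (N.endpoint k 1) := by
      rintro ⟨k, hk⟩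
      obtain ⟨e, -, rfl⟩ := Finset.mem_image.1 hk
      rw [← SimpleGraph.mem_edgeSet, hf]
      exact e.2
    ext a b
    constructor
    · rintro ⟨-, ⟨k, rfl, rfl⟩ | ⟨k, rfl, rfl⟩⟩
      · exact hadj k
      · exact (hadj k).symm
    · intro hab
      refine ⟨hab.ne, ?_⟩
      have hk := hf ⟨s(a, b), hab⟩
      have hmem : f ⟨s(a, b), hab⟩ ∈ Finset.univ.image f :=
        Finset.mem_image_of_mem _ (Finset.mem_univ _)
      rcases Sym2.eq_iff.1 hk with h | h
      · exact Or.inl ⟨⟨_, hmem⟩, h⟩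
      · exact Or.inr ⟨⟨_, hmem⟩, h⟩

variable [Fintype ι]

/-- The state in which the ancillas of the agents in `S` are in a CAT state and the pairs in `F`
have been used. -/
noncomputable def clusterState (S : Finset (Fin n)) (F : Finset ι) : StateVec (NetQubit ι (fun _ : Fin n => 1)) :=
  fun x => partialCat S (fun i => x (ancilla ι i)) *
    ∏ k, pairAmp F k (x (Sum.inl (k, 0))) (x (Sum.inl (k, 1)))

theorem initState_eq_smul :
    initState ι (fun _ : Fin n => 1) = (1 / 2 : ℂ) • clusterState ∅ ∅ := by
  funext x
  have h : (∏ a : (Σ _ : Fin n, Fin 1), if x (Sum.inr a) = 0 then (1 : ℂ) else 0) =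
      if ∀ i, x (ancilla ι i) = 0 then 1 else 0 := by
    rw [Finset.prod_ite_zero]
    simp [Sigma.forall]
  simp only [initState, clusterState, h, partialCat_empty, pairAmp, Finset.notMem_empty, if_false,
    Pi.smul_apply, smul_eq_mul]
  split_ifs <;> ring

variable (N : EPRNetwork n ι)

/-- The steps by which agent `u` adds agent `v` to the CAT state with the help of the pair `k`. -/
noncomputable def linkSteps (k : ι) (s t : Fin 2) {u v : Fin n} (hu : N.endpoint k s = u)
    (hv : N.endpoint k t = v) : List (Step (N.owner fun _ => 1)) :=
  relaySteps (heldAncilla_ne_heldHalf N k s hu) (heldAncilla_ne_heldHalf N k t hv)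

theorem clusterState_eq_mul_pair (S : Finset (Fin n)) (F : Finset ι) (k : ι) {s t : Fin 2}
    (hst : s ≠ t) (x : Config (NetQubit ι (fun _ : Fin n => 1))) :
    clusterState S F x = partialCat S (fun i => x (ancilla ι i)) *
      (pairAmp F k (x (Sum.inl (k, s))) (x (Sum.inl (k, t))) *
        ∏ k' ∈ Finset.univ.erase k, pairAmp F k' (x (Sum.inl (k', 0))) (x (Sum.inl (k', 1)))) := by
  rw [clusterState, ← Finset.mul_prod_erase _ _ (Finset.mem_univ k)]
  congr 2
  have symm : ∀ a b, pairAmp F k a b = pairAmp F k b a := by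
    intro a b
    simp only [pairAmp, eprAmp, and_comm, eq_comm]
  fin_cases s <;> fin_cases t
  · exact absurd rfl hst
  · rfl
  · exact symm _ _
  · exact absurd rfl hst

theorem leadsTo_linkSteps {k : ι} {s t : Fin 2} (hst : s ≠ t) {u v : Fin n}
    (hu : N.endpoint k s = u) (hv : N.endpoint k t = v) {S : Finset (Fin n)} {F : Finset ι}
    (huS : u ∈ S) (hvS : v ∉ S) (hk : k ∉ F) :
    LeadsTo (linkSteps N k s t hu hv) (clusterState S F)
      (clusterState (insert v S) (insert k F)) := by
  -- The scalar is the amplitude of the consumed EPR pair, the same for both outcomes.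
  refine leadsTo_relaySteps _ _ fun m => ⟨1 / (Real.sqrt 2 : ℂ), ?_⟩
  have huv : u ≠ v := fun h => hvS (h ▸ huS)
  funext x
  rw [applyLocal_receiveMatrix, applyLocal_parityKraus]
  simp only [heldAncilla, heldHalf, Pi.smul_apply, smul_eq_mul]
  rw [clusterState_eq_mul_pair S F k hst, clusterState_eq_mul_pair _ _ k hst]
  have hrest : ∀ y : Config (NetQubit ι (fun _ : Fin n => 1)),
      (∀ k' ≠ k, ∀ s, y (Sum.inl (k', s)) = x (Sum.inl (k', s))) →
      ∏ k' ∈ Finset.univ.erase k, pairAmp F k' (y (Sum.inl (k', 0))) (y (Sum.inl (k', 1))) =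
      ∏ k' ∈ Finset.univ.erase k,
        pairAmp (insert k F) k' (x (Sum.inl (k', 0))) (x (Sum.inl (k', 1))) := by
    intro y hy
    refine Finset.prod_congr rfl fun k' hk' => ?_
    have hk' := Finset.ne_of_mem_erase hk'
    rw [hy k' hk', hy k' hk']
    simp [pairAmp, hk']
  have hanc : ∀ (y : Config (NetQubit ι (fun _ : Fin n => 1))) (s : Fin 2) (c : Fin 2),
      (fun i => update y (Sum.inl (k, s)) c (ancilla ι i)) = fun i => y (ancilla ι i) := by
    intro y s c
    funext i
    simp [ancilla]
  rw [hrest _ (fun k' hk' s' => by simp [hk', ancilla]), hanc, hanc, config_update_ancilla,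
    pairAmp_eq_indicator hk]
  have hvu : ancilla ι u ≠ ancilla ι v := fun e => huv (by simpa [ancilla] using e)
  have hts : (Sum.inl (k, t) : NetQubit ι (fun _ : Fin n => 1)) ≠ Sum.inl (k, s) := by
    simpa using hst.symm
  have hst' : (Sum.inl (k, s) : NetQubit ι (fun _ : Fin n => 1)) ≠ Sum.inl (k, t) := hts.symm
  -- The correction by `v` cancels the outcome, so the resulting state does not depend on `m`.
  have hm : ∀ p q r : Fin 2, (p + m = q + r + m) ↔ p = q + r := by
    revert m
    decide
  have hpair : pairAmp (insert k F) k (x (Sum.inl (k, s))) (x (Sum.inl (k, t))) =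
      (if x (Sum.inl (k, s)) = 0 then 1 else 0) * if x (Sum.inl (k, t)) = 0 then 1 else 0 := by
    rw [pairAmp, if_pos (Finset.mem_insert_self _ _), ite_zero_mul_ite_zero]
    simp
  have key := partialCat_insert huS hvS (fun i => x (ancilla ι i)) (x (Sum.inl (k, t)))
  rw [hpair]
  simp only [update_self, update_of_ne hts, update_of_ne hst', update_of_ne hvu, ne_eq,
    reduceCtorEq, not_false_eq_true, update_of_ne, hm]
  by_cases h0 : x (Sum.inl (k, s)) = 0
  · simp only [h0, if_true]
    linear_combination (1 / (Real.sqrt 2 : ℂ)) * key * ∏ k' ∈ Finset.univ.erase k,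
      pairAmp (insert k F) k' (x (Sum.inl (k', 0))) (x (Sum.inl (k', 1)))
  · simp [h0]

theorem leadsTo_hadamard (r : Fin n) :
    ∃ p : List (Step (N.owner fun _ => 1)), (p.map Step.cbits).sum = 0 ∧
      LeadsTo p (initState ι fun _ => 1) (clusterState {r} ∅) := by
  let H : Matrix (Fin 2) (Fin 2) ℂ := (1 / (Real.sqrt 2 : ℂ)) • !![1, 1; 1, -1]
  have h2 : (Real.sqrt 2 : ℂ) * (Real.sqrt 2 : ℂ) = 2 := by
    rw [← Complex.ofReal_mul, Real.mul_self_sqrt (by norm_num)]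
    norm_num
  have hs : (Real.sqrt 2 : ℂ) ≠ 0 := by simp
  have hH : H ∈ Matrix.unitaryGroup (Fin 2) ℂ := by
    rw [Matrix.mem_unitaryGroup_iff']
    ext i j
    fin_cases i <;> fin_cases j <;>
      simp [H, Matrix.mul_apply, Matrix.star_apply, ← mul_inv, h2] <;> norm_num
  refine ⟨[qubitStep r (heldAncilla N r) H hH], rfl, ?_⟩
  intro b hb b' hb'
  obtain ⟨c, hc⟩ := leadsTo_qubitStep r (heldAncilla N r) hH _ b hb b' hb'
  refine ⟨c * (1 / (Real.sqrt 2 : ℂ)), ?_⟩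
  rw [hc, mul_smul]
  congr 1
  funext x
  have hx : ∀ c, ∏ k, pairAmp (∅ : Finset ι) k (update x (ancilla ι r) c (Sum.inl (k, 0)))
      (update x (ancilla ι r) c (Sum.inl (k, 1))) =
      ∏ k, pairAmp (∅ : Finset ι) k (x (Sum.inl (k, 0))) (x (Sum.inl (k, 1))) := by
    intro c
    simp [ancilla]
  have key := sum_mul_partialCat_empty_update (H (x (ancilla ι r))) r fun i => x (ancilla ι i)
  -- Both entries of the first column of the Hadamard matrix agree, so |0⟩ becomes an equal
  -- superposition.
  have hH0 : H (x (ancilla ι r)) 0 = 1 / (Real.sqrt 2 : ℂ) := by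
    generalize x (ancilla ι r) = b
    fin_cases b <;> simp [H]
  rw [hH0] at key
  simp only [initState_eq_smul, clusterState, Pi.smul_apply, smul_eq_mul, heldAncilla,
    config_update_ancilla, hx, Fin.sum_univ_two] at key ⊢
  linear_combination (1 / 2 : ℂ) * key *
    ∏ k, pairAmp (∅ : Finset ι) k (x (Sum.inl (k, 0))) (x (Sum.inl (k, 1)))

/-- Used pairs have both ends inside `S`, so any pair crossing the boundary of `S` is still fresh;
connectedness supplies one as long as `S` is not everything. -/
theorem exists_growSteps (hN : N.eprGraph.Connected) (r : Fin n) (k : ℕ) (hk : k < n) :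
    ∃ (S : Finset (Fin n)) (F : Finset ι) (p : List (Step (N.owner fun _ => 1))),
      S.card = k + 1 ∧ r ∈ S ∧ (∀ k ∈ F, ∀ s, N.endpoint k s ∈ S) ∧
      (p.map Step.cbits).sum = k ∧ LeadsTo p (initState ι fun _ => 1) (clusterState S F) := by
  induction k with
  | zero =>
    obtain ⟨p, hp, hl⟩ := leadsTo_hadamard N r
    exact ⟨{r}, ∅, p, by simp, by simp, by simp, hp, hl⟩
  | succ k ih =>
    obtain ⟨S, F, p, hS, hr, hF, hp, hl⟩ := ih (by omega)
    obtain ⟨w, hw⟩ : ∃ w, w ∉ S := by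
      by_contra! h
      have := Finset.card_eq_of_equiv_fin (Equiv.subtypeUnivEquiv h)
      omega
    obtain ⟨d, -, hu, hv⟩ := (hN.preconnected r w).some.exists_boundary_dart S hr hw
    obtain ⟨k', s, t, hst, hs, ht⟩ : ∃ k' s t, s ≠ t ∧ N.endpoint k' s = d.fst ∧
        N.endpoint k' t = d.snd := by
      obtain ⟨-, ⟨k', h0, h1⟩ | ⟨k', h0, h1⟩⟩ := d.adj
      · exact ⟨k', 0, 1, by decide, h0, h1⟩
      · exact ⟨k', 1, 0, by decide, h1, h0⟩
    refine ⟨insert d.snd S, insert k' F, p ++ linkSteps N k' s t hs ht, ?_, ?_, ?_, ?_,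
      hl.append (leadsTo_linkSteps N hst hs ht hu hv fun h => hv (ht ▸ hF k' h t))⟩
    · rw [Finset.card_insert_of_notMem hv, hS]
    · exact Finset.mem_insert_of_mem hr
    · intro j hj s'
      rcases Finset.mem_insert.1 hj with rfl | hj
      · have : s' = s ∨ s' = t := by omega
        rcases this with rfl | rfl
        · exact Finset.mem_insert_of_mem (hs ▸ hu)
        · exact ht ▸ Finset.mem_insert_self _ _
      · exact Finset.mem_insert_of_mem (hF j hj s')
    · simp [hp, linkSteps, relaySteps, Step.cbits]

theorem sum_tensorApply_update (V : Fin n → Matrix (Fin 2) (Fin 2) ℂ)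
    (W : Matrix (Fin 2) (Fin 2) ℂ) (g : StateVec (Fin n)) (i : Fin n) (a : Config (Fin n)) :
    ∑ s, W (a i) s * tensorApply V g (update a i s) =
      tensorApply (update V i (W * V i)) g a := by
  simp only [tensorApply, Finset.mul_sum]
  rw [Finset.sum_comm]
  refine Finset.sum_congr rfl fun y _ => ?_
  rw [← Finset.mul_prod_erase _ _ (Finset.mem_univ i)]
  have h : ∀ s, ∏ j, V j (update a i s j) (y j) =
      V i s (y i) * ∏ j ∈ Finset.univ.erase i, V j (a j) (y j) := by
    intro s
    rw [← Finset.mul_prod_erase _ _ (Finset.mem_univ i), update_self]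
    congr 1
    refine Finset.prod_congr rfl fun j hj => ?_
    rw [update_of_ne (Finset.ne_of_mem_erase hj)]
  have h' : ∏ j ∈ Finset.univ.erase i, update V i (W * V i) j (a j) (y j) =
      ∏ j ∈ Finset.univ.erase i, V j (a j) (y j) :=
    Finset.prod_congr rfl fun j hj => by rw [update_of_ne (Finset.ne_of_mem_erase hj)]
  simp only [h, h', update_self, Matrix.mul_apply, Finset.sum_mul]
  exact Finset.sum_congr rfl fun s _ => by ring

/-- The agents in `s` act one after another; the state χ of the pairs is a spectator. -/
theorem exists_localUnitarySteps (U : Fin n → Matrix (Fin 2) (Fin 2) ℂ)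
    (hU : ∀ i, U i ∈ Matrix.unitaryGroup (Fin 2) ℂ) (g : StateVec (Fin n))
    (χ : StateVec (ι × Fin 2)) (s : Finset (Fin n)) :
    ∃ p : List (Step (N.owner fun _ => 1)), (p.map Step.cbits).sum = 0 ∧
      LeadsTo p (fun x => g (fun i => x (ancilla ι i)) * χ fun q => x (Sum.inl q))
        fun x => tensorApply (fun i => if i ∈ s then U i else 1) g (fun i => x (ancilla ι i)) *
          χ fun q => x (Sum.inl q) := by
  induction s using Finset.induction_on with
  | empty =>
    refine ⟨[], rfl, ?_⟩
    simp only [Finset.notMem_empty, if_false, tensorApply_one]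
    exact LeadsTo.nil _
  | insert j s hj ih =>
    obtain ⟨p, hp, hl⟩ := ih
    refine ⟨p ++ [qubitStep j (heldAncilla N j) (U j) (hU j)], by
      simp [hp, qubitStep, Step.cbits], ?_⟩
    convert hl.append (leadsTo_qubitStep j (heldAncilla N j) (hU j) _) using 1
    funext x
    have hx : ∀ c, (fun q => update x (ancilla ι j) c (Sum.inl q)) = fun q => x (Sum.inl q) := by
      intro c
      funext q
      simp [ancilla]
    simp only [heldAncilla, config_update_ancilla, hx, ← mul_assoc]
    rw [← Finset.sum_mul, sum_tensorApply_update _ (U j) g j fun i => x (ancilla ι i)]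
    congr 2
    funext i
    by_cases hi : i = j
    · subst hi
      simp [hj]
    · simp [hi]

theorem EPRNetwork.exists_protocol (hn : 2 ≤ n) (hN : N.eprGraph.Connected) {φ : StateVec (Fin n)}
    (hφ : IsMaxEntangled φ) : ∃ P : Protocol N, P.Prepares φ ∧ P.cbits ≤ 3 * n - 5 := by
  obtain ⟨U, hU, hφ⟩ := hφ
  obtain ⟨S, F, p, hS, -, -, hp, hl⟩ := exists_growSteps N hN ⟨0, by omega⟩ (n - 1) (by omega)
  have hS : S = Finset.univ := by
    rw [← Finset.card_eq_iff_eq_univ, hS, Fintype.card_fin]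
    omega
  subst hS
  obtain ⟨q, hq, hl'⟩ := exists_localUnitarySteps N U hU (partialCat Finset.univ)
    (fun y => ∏ k, pairAmp F k (y (k, 0)) (y (k, 1))) Finset.univ
  refine ⟨⟨fun _ => 1, p ++ q, ancilla ι, fun _ => rfl⟩, ?_, ?_⟩
  · intro b hb
    obtain ⟨c, hc⟩ := (hl.append hl') _ ⟨1, (one_smul _ _).symm⟩ b hb
    have hinl : ∀ q : ι × Fin 2, (Sum.inl q : NetQubit ι (fun _ : Fin n => 1)) ∉
        Set.range (ancilla ι) := by
      rintro q ⟨i, hi⟩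
      simp [ancilla] at hi
    -- The factor √2 compensates for `partialCat` being unnormalised.
    refine ⟨fun y => c * (Real.sqrt 2 : ℂ) *
      ∏ k, pairAmp F k (y ⟨Sum.inl (k, 0), hinl _⟩) (y ⟨Sum.inl (k, 1), hinl _⟩), fun x => ?_⟩
    have hs : (Real.sqrt 2 : ℂ) ≠ 0 := by simp
    have hφ' : φ = (1 / (Real.sqrt 2 : ℂ)) • tensorApply U (partialCat Finset.univ) := by
      funext a
      rw [hφ, catState_eq_smul]
      simp only [tensorApply, Pi.smul_apply, smul_eq_mul, Finset.mul_sum]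
      exact Finset.sum_congr rfl fun y _ => by ring
    rw [hc, hφ']
    simp only [Finset.mem_univ, if_true, Pi.smul_apply, smul_eq_mul]
    field_simp
  · simp only [Protocol.cbits, List.map_append, List.sum_append, hp, hq]
    -- The count is n - 1, and n - 1 ≤ 3n - 5 uses n ≥ 2, with equality at n = 2.
    omega

end Cluster
end LOCC

theorem mainTheorem1 (n : ℕ) (hn : 2 ≤ n) {ι : Type*} [Fintype ι] [DecidableEq ι]
    (N : LOCC.EPRNetwork n ι) (φ : LOCC.StateVec (Fin n)) (hφ : LOCC.IsMaxEntangled φ) :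
    ((∃ P : LOCC.Protocol N, P.Prepares φ) ↔ N.eprGraph.Connected) ∧
    (N.eprGraph.Connected → ∃ P : LOCC.Protocol N, P.Prepares φ ∧ P.cbits ≤ 3 * n - 5) ∧
    (∀ T : SimpleGraph (Fin n), T ≤ N.eprGraph → T.IsTree →
      ∃ s : Finset ι, s.card = n - 1 ∧ (N.restrict s).eprGraph = T ∧
        ∃ P : LOCC.Protocol (N.restrict s), P.Prepares φ ∧ P.cbits ≤ 3 * n - 5) := by
  refine ⟨⟨fun ⟨P, hP⟩ => LOCC.EPRNetwork.connected_of_prepares (by omega) hφ P hP, fun h => ?_⟩,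
    fun h => N.exists_protocol hn h hφ, fun T hT hT' => ?_⟩
  · obtain ⟨P, hP, -⟩ := N.exists_protocol hn h hφ
    exact ⟨P, hP⟩
  · obtain ⟨s, hs, h⟩ := N.exists_restrict_eq T hT hT'
    exact ⟨s, hs, h, (N.restrict s).exists_protocol hn (h ▸ hT'.connected) hφ⟩
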